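/- Let $n\in\{1,3,5\}$ and let $J_0\ge n$ be an integer. Put $J_k=2^kJ_0$ and $N_k=J_k+1$, and write the vectors of $\mathbb R^{N_k}$ as $z=(z_0,\dots,z_{J_k})$. Let $P_k^{k+1}:\mathbb R^{N_k}\to\mathbb R^{N_{k+1}}$, $k\ge 0$, be the linear prediction operators given as follows. At even indices, $(P_k^{k+1}z)_{2i}=z_i$ for $0\le i\le J_k$. At odd indices, $$(P_k^{k+1}z)_{2i-1}=\sum_{m=1}^{(n+1)/2}\beta_m\,(z_{i+m-1}+z_{i-m}),\qquad \tfrac{n+1}{2}\le i\le J_k-\tfrac{n-1}{2},$$ where $\beta_1=\frac12$ if $n=1$; $(\beta_1,\beta_2)=(\frac9{16},-\frac1{16})$ if $n=3$; $(\beta_1,\beta_2,\beta_3)=(\frac{150}{256},-\frac{25}{256},\frac{3}{256})$ if $n=5$. The remaining odd entries near the left end are given, for $n=3$, by $$(P_k^{k+1}z)_1=\tfrac5{16}z_0+\tfrac{15}{16}z_1-\tfrac5{16}z_2+\tfrac1{16}z_3,$$ and, for $n=5$, by $$(P_k^{k+1}z)_1=\tfrac{63}{256}z_0+\tfrac{315}{256}z_1-\tfrac{105}{128}z_2+\tfrac{63}{128}z_3-\tfrac{45}{256}z_4+\tfrac{7}{256}z_5,$$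 $$(P_k^{k+1}z)_3=-\tfrac{7}{256}z_0+\tfrac{105}{256}z_1+\tfrac{105}{128}z_2-\tfrac{35}{128}z_3+\tfrac{21}{256}z_4-\tfrac{3}{256}z_5;$$ those near the right end are given by the same rules under the reflections $i\mapsto J_k-i$ of coarse indices and $j\mapsto J_{k+1}-j$ of fine indices. For $0\le\ell\le k$ let $P_\ell^k=P_{k-1}^k\cdots P_{\ell+1}^{\ell+2}P_\ell^{\ell+1}$, with $P_\ell^\ell$ the identity. Then there is a constant $C>0$, independent of $\ell$ and $k$, such that $$\|\varepsilon^\ell\|_\infty\le\|P_\ell^k\varepsilon^\ell\|_\infty\le C\,\|\varepsilon^\ell\|_\infty\qquad\text{for all } 0\le\ell\le k \text{ and all } \varepsilon^\ell\in\mathbb R^{N_\ell}.$$ Hence the sequence $(P_k^{k+1})_{k\ge0}$ satisfies Property S with $d_1=1$: there is $d_2>0$ such that $d_1\|z\|_\infty\le\|P_\ell^kz\|_\infty\le d_2\|z\|_\infty$ for all $0\le\ell<k$ and all $z\in\mathbb R^{N_\ell}$, with $d_1=1$. -/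

import Mathlib

/-! Sequences of linear prediction operators and Property S -/

/-- The recursive prediction `P_ℓ^k = P_{k-1}^k ⋯ P_ℓ^{ℓ+1}` for `ℓ ≤ k` (with `P_ℓ^ℓ` the identity),
where `P k` is the operator `P_k^{k+1}` from level `k` data (a vector of length `N k`) to
level `k + 1` data. -/
noncomputable def recursivePrediction {N : ℕ → ℕ}
    (P : ∀ k, (Fin (N k) → ℝ) →ₗ[ℝ] (Fin (N (k + 1)) → ℝ)) (ℓ k : ℕ) (h : ℓ ≤ k) :
    (Fin (N ℓ) → ℝ) →ₗ[ℝ] (Fin (N k) → ℝ) :=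
  Nat.leRecOn (C := fun k => (Fin (N ℓ) → ℝ) →ₗ[ℝ] (Fin (N k) → ℝ)) h
    (fun {k} Q => (P k).comp Q) LinearMap.id

theorem recursivePrediction_self {N : ℕ → ℕ}
    (P : ∀ k, (Fin (N k) → ℝ) →ₗ[ℝ] (Fin (N (k + 1)) → ℝ)) (ℓ : ℕ) :
    recursivePrediction P ℓ ℓ le_rfl = LinearMap.id :=
  Nat.leRecOn_self _

theorem recursivePrediction_succ {N : ℕ → ℕ}
    (P : ∀ k, (Fin (N k) → ℝ) →ₗ[ℝ] (Fin (N (k + 1)) → ℝ)) (ℓ k : ℕ) (h : ℓ ≤ k) :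
    recursivePrediction P ℓ (k + 1) (Nat.le_succ_of_le h) =
      (P k).comp (recursivePrediction P ℓ k h) :=
  Nat.leRecOn_succ h _

/-- Property S with the constants `d₁, d₂ > 0`. The norm on `Fin m → ℝ` is the maximum norm. -/
def PropertySWith {N : ℕ → ℕ}
    (P : ∀ k, (Fin (N k) → ℝ) →ₗ[ℝ] (Fin (N (k + 1)) → ℝ)) (d₁ d₂ : ℝ) : Prop :=
  0 < d₁ ∧ 0 < d₂ ∧ ∀ (ℓ k : ℕ) (h : ℓ < k) (z : Fin (N ℓ) → ℝ),
    d₁ * ‖z‖ ≤ ‖recursivePrediction P ℓ k h.le z‖ ∧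
      ‖recursivePrediction P ℓ k h.le z‖ ≤ d₂ * ‖z‖

/-! The interpolatory prediction operators of degree `1`, `3`, `5` on an interval -/

/-- The number `J_k = 2 ^ k * J₀` of cells of the `k`-th dyadic grid `{i / J_k : 0 ≤ i ≤ J_k}`. -/
def gridCells (J₀ : ℕ) : ℕ → ℕ
  | 0 => J₀
  | k + 1 => 2 * gridCells J₀ k

theorem gridCells_eq (J₀ k : ℕ) : gridCells J₀ k = 2 ^ k * J₀ := by
  induction k with
  | zero => simp [gridCells]
  | succ k ih => rw [gridCells, ih, pow_succ]; ring

/-- The entry `z_i`, for a natural number `i`, of a vector `(z_0, …, z_J)`. The value `0` outside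
`0 ≤ i ≤ J` is never used by the rules below when `n ≤ J`. -/
def entry {J : ℕ} (z : Fin (J + 1) → ℝ) (i : ℕ) : ℝ :=
  if h : i < J + 1 then z ⟨i, h⟩ else 0

/-- The coefficients `β_ℓ` of the centered rule of degree `n`. -/
noncomputable def centeredCoeff : ℕ → ℕ → ℝ
  | 1, 1 => 1 / 2
  | 3, 1 => 9 / 16
  | 3, 2 => -1 / 16
  | 5, 1 => 150 / 256
  | 5, 2 => -25 / 256
  | 5, 3 => 3 / 256
  | _, _ => 0

/-- The centered rule of degree `n` for the fine value with index `2 i - 1`, which sits at the midpoint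
of the coarse nodes `i - 1` and `i`. -/
noncomputable def centeredRule (n : ℕ) (z : ℕ → ℝ) (i : ℕ) : ℝ :=
  ∑ ℓ ∈ Finset.Icc 1 ((n + 1) / 2), centeredCoeff n ℓ * (z (i + ℓ - 1) + z (i - ℓ))

/-- The special rules of degree `n` at the left end, for the fine value with index `2 i - 1`,
`1 ≤ i ≤ (n - 1) / 2`. -/
noncomputable def leftRule : ℕ → (ℕ → ℝ) → ℕ → ℝ
  | 3, z, 1 => 5 / 16 * z 0 + 15 / 16 * z 1 - 5 / 16 * z 2 + 1 / 16 * z 3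
  | 5, z, 1 => 63 / 256 * z 0 + 315 / 256 * z 1 - 105 / 128 * z 2 + 63 / 128 * z 3
      - 45 / 256 * z 4 + 7 / 256 * z 5
  | 5, z, 2 => -7 / 256 * z 0 + 105 / 256 * z 1 + 105 / 128 * z 2 - 35 / 128 * z 3
      + 21 / 256 * z 4 - 3 / 256 * z 5
  | _, _, _ => 0

/-- The predicted value with odd index `2 i - 1`, `1 ≤ i ≤ J`; the rules at the right end are the mirror
images of those at the left end. -/
noncomputable def oddRule (n J : ℕ) (z : ℕ → ℝ) (i : ℕ) : ℝ :=
  if i < (n + 1) / 2 then leftRule n z i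
  else if i ≤ J - (n - 1) / 2 then centeredRule n z i
  else leftRule n (fun m => z (J - m)) (J + 1 - i)

theorem entry_add {J : ℕ} (x y : Fin (J + 1) → ℝ) (i : ℕ) :
    entry (x + y) i = entry x i + entry y i := by
  unfold entry; split <;> simp

theorem entry_smul {J : ℕ} (c : ℝ) (x : Fin (J + 1) → ℝ) (i : ℕ) :
    entry (c • x) i = c * entry x i := by
  unfold entry; split <;> simp

theorem leftRule_add (n : ℕ) (x y : ℕ → ℝ) (i : ℕ) :
    leftRule n (fun m => x m + y m) i = leftRule n x i + leftRule n y i := by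
  unfold leftRule; split <;> ring

theorem leftRule_smul (n : ℕ) (c : ℝ) (x : ℕ → ℝ) (i : ℕ) :
    leftRule n (fun m => c * x m) i = c * leftRule n x i := by
  unfold leftRule; split <;> ring

theorem oddRule_add (n J : ℕ) (x y : ℕ → ℝ) (i : ℕ) :
    oddRule n J (fun m => x m + y m) i = oddRule n J x i + oddRule n J y i := by
  unfold oddRule centeredRule
  split_ifs
  · exact leftRule_add n x y i
  · rw [← Finset.sum_add_distrib]
    exact Finset.sum_congr rfl fun _ _ => by ring
  · exact leftRule_add n _ _ _

theorem oddRule_smul (n J : ℕ) (c : ℝ) (x : ℕ → ℝ) (i : ℕ) :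
    oddRule n J (fun m => c * x m) i = c * oddRule n J x i := by
  unfold oddRule centeredRule
  split_ifs
  · exact leftRule_smul n c x i
  · rw [Finset.mul_sum]
    exact Finset.sum_congr rfl fun _ _ => by ring
  · exact leftRule_smul n c _ _

/-- One prediction step of degree `n`, from the values on a grid with `J` cells to the values on the
refined grid with `2 J` cells. -/
noncomputable def predictStep (n J : ℕ) : (Fin (J + 1) → ℝ) →ₗ[ℝ] (Fin (2 * J + 1) → ℝ) where
  toFun z j :=
    if j.val % 2 = 0 then entry z (j.val / 2) else oddRule n J (entry z) ((j.val + 1) / 2)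
  map_add' x y := by
    have e : entry (x + y) = fun m => entry x m + entry y m := funext (entry_add x y)
    funext j
    simp only [e, oddRule_add, Pi.add_apply]
    split_ifs <;> rfl
  map_smul' c x := by
    have e : entry (c • x) = fun m => c * entry x m := funext (entry_smul c x)
    funext j
    simp only [e, oddRule_smul, Pi.smul_apply, smul_eq_mul, RingHom.id_apply]
    split_ifs <;> rfl

/-- The sequence `(P_k^{k+1})_k` of prediction operators of degree `n`, with `J₀` cells at level `0`;
level `k` data has the `N_k = J_k + 1` entries `z_0, …, z_{J_k}`. -/
noncomputable def interpPrediction (n J₀ k : ℕ) :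
    (Fin (gridCells J₀ k + 1) → ℝ) →ₗ[ℝ] (Fin (gridCells J₀ (k + 1) + 1) → ℝ) :=
  predictStep n (gridCells J₀ k)

/-! Even entries are copied, so norms never decrease; this gives the lower bound. For the upper
bound, it is enough that first differences decay geometrically, since a new odd value differs from
its even neighbour by one first difference of the fine grid, and these corrections sum to a bounded
total. In the interior, the centered rule contracts first differences by `3 / 4`
(`centeredRule_difference_le`). The end rules need not contract in one step, but near an end the `n
+ 1` outermost values evolve autonomously and the rules are exact in degree `n`. Hence these values
stay samples of one fixed polynomial on ever finer nodes, and their differences decay like `2⁻ᵏ`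
(`exists_end_difference_bound`). -/

/-! ### Localization at the two ends. -/

/-- `v` is obtained from the values `u` on a grid with `J` cells by one prediction step. -/
def IsPrediction (n J : ℕ) (u v : ℕ → ℝ) : Prop :=
  (∀ i ≤ J, v (2 * i) = u i) ∧ ∀ i, 1 ≤ i → i ≤ J → v (2 * i - 1) = oddRule n J u i

/-- The relations of one prediction step among the first `n + 1` values. -/
def IsEndPrediction (n : ℕ) (u v : ℕ → ℝ) : Prop :=
  (∀ i, 2 * i ≤ n → v (2 * i) = u i) ∧
    (∀ i, 1 ≤ i → i < (n + 1) / 2 → v (2 * i - 1) = leftRule n u i) ∧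
    v n = centeredRule n u ((n + 1) / 2)

/-- Fine index `n` is the first one with a centered rule, whose stencil is exactly the coarse
indices `0, …, n`; so the first `n + 1` values form a closed system. -/
theorem IsPrediction.left {n J : ℕ} (hn : n = 1 ∨ n = 3 ∨ n = 5) (hJ : n ≤ J) {u v : ℕ → ℝ}
    (h : IsPrediction n J u v) : IsEndPrediction n u v := by
  refine ⟨fun i hi => h.1 i (by omega), fun i h1 h2 => ?_, ?_⟩
  · rw [h.2 i h1 (by omega), oddRule, if_pos h2]
  · have := h.2 ((n + 1) / 2) (by omega) (by omega)
    rw [oddRule, if_neg (by omega), if_pos (by omega)] at this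
    rwa [show 2 * ((n + 1) / 2) - 1 = n by omega] at this

theorem centeredRule_mirror {n J : ℕ} (hJ : n ≤ J) (u : ℕ → ℝ) :
    centeredRule n u (J + 1 - (n + 1) / 2) =
      centeredRule n (fun m => u (J - m)) ((n + 1) / 2) := by
  unfold centeredRule
  refine Finset.sum_congr rfl fun m hm => ?_
  rw [Finset.mem_Icc] at hm
  have e1 : J - ((n + 1) / 2 + m - 1) = J + 1 - (n + 1) / 2 - m := by omega
  have e2 : J - ((n + 1) / 2 - m) = J + 1 - (n + 1) / 2 + m - 1 := by omega
  simp only [e1, e2]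
  rw [add_comm (u _)]

/-- Reflection turns the right end into a left end, since `2 J - (2 i - 1) = 2 (J + 1 - i) - 1`. -/
theorem IsPrediction.right {n J : ℕ} (hn : n = 1 ∨ n = 3 ∨ n = 5) (hJ : n ≤ J) {u v : ℕ → ℝ}
    (h : IsPrediction n J u v) :
    IsEndPrediction n (fun m => u (J - m)) (fun m => v (2 * J - m)) := by
  refine ⟨fun i hi => ?_, fun i h1 h2 => ?_, ?_⟩
  · change v (2 * J - 2 * i) = u (J - i)
    rw [← h.1 (J - i) (by omega)]
    congr 1; omega
  · have := h.2 (J + 1 - i) (by omega) (by omega)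
    rw [oddRule, if_neg (by omega), if_neg (by omega),
      show J + 1 - (J + 1 - i) = i by omega] at this
    rw [← this]
    change v _ = v _
    congr 1; omega
  · have := h.2 (J + 1 - (n + 1) / 2) (by omega) (by omega)
    rw [oddRule, if_neg (by omega), if_pos (by omega), centeredRule_mirror hJ] at this
    rw [← this]
    change v _ = v _
    congr 1; omega

/-! ### Polynomial exactness and decay at the ends. -/

/-- The end rules are exact for polynomials of degree `n`. -/
theorem IsEndPrediction.eq_sum {n : ℕ} (hn : n = 1 ∨ n = 3 ∨ n = 5) {u v c : ℕ → ℝ}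
    (h : IsEndPrediction n u v)
    (hu : ∀ i ≤ n, u i = ∑ m ∈ Finset.range (n + 1), c m * (i : ℝ) ^ m) (i : ℕ) (hi : i ≤ n) :
    v i = ∑ m ∈ Finset.range (n + 1), c m / 2 ^ m * (i : ℝ) ^ m := by
  obtain ⟨he, ho, hc⟩ := h
  rcases Nat.even_or_odd' i with ⟨j, rfl | rfl⟩
  · rw [he j hi, hu j (by omega)]
    refine Finset.sum_congr rfl fun m _ => ?_
    push_cast
    rw [mul_pow]
    field_simp
  · rcases hn with rfl | rfl | rfl
    · obtain rfl : j = 0 := by omega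
      rw [mul_zero, zero_add, hc]
      simp [centeredRule, centeredCoeff, hu, Finset.sum_range_succ]
      ring
    · have hj : j = 0 ∨ j = 1 := by omega
      rcases hj with rfl | rfl
      · have := ho 1 le_rfl (by norm_num)
        norm_num at this
        rw [mul_zero, zero_add, this]
        simp [leftRule, hu, Finset.sum_range_succ]
        ring
      · norm_num
        rw [hc]
        simp [centeredRule, centeredCoeff, hu, Finset.sum_range_succ, Finset.sum_Icc_succ_top]
        ring
    · have hj : j = 0 ∨ j = 1 ∨ j = 2 := by omega
      rcases hj with rfl | rfl | rfl
      · have := ho 1 le_rfl (by norm_num)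
        norm_num at this
        rw [mul_zero, zero_add, this]
        simp [leftRule, hu, Finset.sum_range_succ]
        ring
      · have := ho 2 (by norm_num) (by norm_num)
        norm_num at this
        norm_num
        rw [this]
        simp [leftRule, hu, Finset.sum_range_succ]
        ring
      · norm_num
        rw [hc]
        simp [centeredRule, centeredCoeff, hu, Finset.sum_range_succ, Finset.sum_Icc_succ_top]
        ring

/-- The coefficients of the interpolation polynomial at `0, …, n` are controlled by the values. -/
theorem exists_interpolation_coeff_bound (n : ℕ) :
    ∃ K : ℝ, 0 ≤ K ∧ ∀ (z : ℕ → ℝ) (B : ℝ), (∀ i ≤ n, |z i| ≤ B) →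
      ∃ c : ℕ → ℝ, (∀ m, m ≤ n → |c m| ≤ K * B) ∧
        ∀ i ≤ n, z i = ∑ m ∈ Finset.range (n + 1), c m * (i : ℝ) ^ m := by
  set s := Finset.range (n + 1)
  set b : ℕ → Polynomial ℝ := fun i => Lagrange.basis s (fun j : ℕ => (j : ℝ)) i
  have hinj : Set.InjOn (fun j : ℕ => (j : ℝ)) s := fun x _ y _ h => Nat.cast_injective h
  -- The constant is the sum of all absolute coefficients of the Lagrange basis polynomials.
  refine ⟨∑ m ∈ s, ∑ i ∈ s, |(b i).coeff m|, by positivity, fun z B hz => ?_⟩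
  have hB : 0 ≤ B := (abs_nonneg _).trans (hz 0 (Nat.zero_le _))
  set p := Lagrange.interpolate s (fun j : ℕ => (j : ℝ)) z
  refine ⟨p.coeff, fun m hm => ?_, fun i hi => ?_⟩
  · have hp : p.coeff m = ∑ i ∈ s, z i * (b i).coeff m := by
      simp [p, b, Lagrange.interpolate_apply]
    calc |p.coeff m| ≤ ∑ i ∈ s, |z i * (b i).coeff m| := hp ▸ Finset.abs_sum_le_sum_abs _ _
      _ ≤ ∑ i ∈ s, |(b i).coeff m| * B := by
          refine Finset.sum_le_sum fun i hi => ?_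
          rw [abs_mul, mul_comm]
          exact mul_le_mul_of_nonneg_left
            (hz i (Nat.lt_succ_iff.1 (Finset.mem_range.1 hi))) (abs_nonneg _)
      _ = (∑ i ∈ s, |(b i).coeff m|) * B := by rw [Finset.sum_mul]
      _ ≤ _ := by
          refine mul_le_mul_of_nonneg_right ?_ hB
          exact Finset.single_le_sum (f := fun m => ∑ i ∈ s, |(b i).coeff m|)
            (fun _ _ => Finset.sum_nonneg fun _ _ => abs_nonneg _)
            (Finset.mem_range.2 (Nat.lt_succ_of_le hm))
  · have h1 : p.eval (i : ℝ) = z i :=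
      Lagrange.eval_interpolate_at_node z hinj (Finset.mem_range.2 (Nat.lt_succ_of_le hi))
    have h2 : p.degree < (n + 1 : ℕ) := by
      simpa only [s, Finset.card_range] using Lagrange.degree_interpolate_lt z hinj
    rw [← h1, Polynomial.eval_eq_sum_range' (n := n + 1)]
    rcases eq_or_ne p 0 with h0 | h0
    · simp [h0]
    · exact (Polynomial.natDegree_lt_iff_degree_lt h0).2 h2

/-- First differences of successive predictions decay like `2⁻ᵏ` near an end of the interval. -/
theorem exists_end_difference_bound {n : ℕ} (hn : n = 1 ∨ n = 3 ∨ n = 5) :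
    ∃ K : ℝ, 0 ≤ K ∧ ∀ (u : ℕ → ℕ → ℝ) (B : ℝ), (∀ k, IsEndPrediction n (u k) (u (k + 1))) →
      (∀ i ≤ n, |u 0 i| ≤ B) → ∀ k, ∀ j < n, |u k (j + 1) - u k j| ≤ K * B / 2 ^ k := by
  obtain ⟨K, hK, hc⟩ := exists_interpolation_coeff_bound n
  refine ⟨∑ m ∈ Finset.range (n + 1), K * (n : ℝ) ^ m, by positivity, fun u B hu hB k j hj => ?_⟩
  obtain ⟨c, hcB, hcu⟩ := hc _ B hB
  have hB0 : 0 ≤ B := (abs_nonneg _).trans (hB 0 (Nat.zero_le _))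
  have key : ∀ k, ∀ i ≤ n,
      u k i = ∑ m ∈ Finset.range (n + 1), c m / (2 ^ m) ^ k * (i : ℝ) ^ m := by
    intro k
    induction k with
    | zero => simpa using hcu
    | succ k ih =>
      intro i hi
      rw [(hu k).eq_sum hn ih i hi]
      refine Finset.sum_congr rfl fun m _ => ?_
      rw [div_div, ← pow_succ]
  rw [key k _ hj, key k _ hj.le, ← Finset.sum_sub_distrib, Finset.sum_mul, Finset.sum_div]
  refine (Finset.abs_sum_le_sum_abs _ _).trans (Finset.sum_le_sum fun m hm => ?_)
  rw [← mul_sub, abs_mul, abs_div, abs_of_pos (by positivity : (0 : ℝ) < (2 ^ m) ^ k)]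
  -- The constant term, the only one that does not decay in `k`, cancels in the difference.
  rcases Nat.eq_zero_or_pos m with rfl | hm0
  · simp only [pow_zero, sub_self, abs_zero, mul_zero]
    positivity
  have h1 : |c m| ≤ K * B := hcB m (Nat.lt_succ_iff.1 (Finset.mem_range.1 hm))
  have h2 : |((j + 1 : ℕ) : ℝ) ^ m - (j : ℝ) ^ m| ≤ (n : ℝ) ^ m := by
    have a1 : ((j + 1 : ℕ) : ℝ) ^ m ≤ (n : ℝ) ^ m :=
      pow_le_pow_left₀ (by positivity) (by exact_mod_cast hj) m
    have a2 : (j : ℝ) ^ m ≤ ((j + 1 : ℕ) : ℝ) ^ m :=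
      pow_le_pow_left₀ (by positivity) (by push_cast; linarith) m
    have a3 : (0 : ℝ) ≤ (j : ℝ) ^ m := by positivity
    rw [abs_of_nonneg (by linarith)]
    linarith
  have h3 : (2 : ℝ) ^ k ≤ (2 ^ m) ^ k := by
    refine pow_le_pow_left₀ (by norm_num) ?_ k
    exact le_self_pow₀ (by norm_num) hm0.ne'
  calc |c m| / (2 ^ m) ^ k * |((j + 1 : ℕ) : ℝ) ^ m - (j : ℝ) ^ m|
      ≤ K * B / 2 ^ k * (n : ℝ) ^ m := by gcongr
    _ = K * (n : ℝ) ^ m * B / 2 ^ k := by ring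

/-! ### Geometric decay of differences on the whole grid. -/

/-- The centered rules contract first differences by the factor `3 / 4`. -/
theorem centeredRule_difference_le {n : ℕ} (hn : n = 1 ∨ n = 3 ∨ n = 5) {J : ℕ} (hJ : n ≤ J)
    {u : ℕ → ℝ} {E : ℝ} (hE : ∀ j < J, |u (j + 1) - u j| ≤ E) {i : ℕ} (h1 : (n + 1) / 2 ≤ i)
    (h2 : i ≤ J - (n - 1) / 2) :
    |u i - centeredRule n u i| ≤ 3 / 4 * E ∧ |centeredRule n u i - u (i - 1)| ≤ 3 / 4 * E := by
  -- Written in first differences, both half-steps have absolute weights summing to `1/2`, `5/8`,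
  -- `89/128` for `n = 1, 3, 5`; `3/4` bounds all three.
  rcases hn with rfl | rfl | rfl
  · obtain ⟨a, rfl⟩ : ∃ a, i = a + 1 := ⟨i - 1, by omega⟩
    have e0 := abs_le.1 (hE a (by omega))
    simp only [centeredRule, centeredCoeff, Nat.reduceAdd, Nat.reduceDiv, Finset.Icc_self,
      Finset.sum_singleton, Nat.add_sub_cancel, abs_le]
    refine ⟨⟨?_, ?_⟩, ?_, ?_⟩ <;> linarith
  · obtain ⟨a, rfl⟩ : ∃ a, i = a + 2 := ⟨i - 2, by omega⟩
    have e0 := abs_le.1 (hE a (by omega))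
    have e1 := abs_le.1 (hE (a + 1) (by omega))
    have e2 := abs_le.1 (hE (a + 2) (by omega))
    simp [centeredRule, centeredCoeff, Finset.sum_Icc_succ_top, abs_le, add_assoc] at *
    refine ⟨⟨?_, ?_⟩, ?_, ?_⟩ <;> linarith
  · obtain ⟨a, rfl⟩ : ∃ a, i = a + 3 := ⟨i - 3, by omega⟩
    have e0 := abs_le.1 (hE a (by omega))
    have e1 := abs_le.1 (hE (a + 1) (by omega))
    have e2 := abs_le.1 (hE (a + 2) (by omega))
    have e3 := abs_le.1 (hE (a + 3) (by omega))
    have e4 := abs_le.1 (hE (a + 4) (by omega))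
    simp [centeredRule, centeredCoeff, Finset.sum_Icc_succ_top, abs_le, add_assoc] at *
    refine ⟨⟨?_, ?_⟩, ?_, ?_⟩ <;> linarith

/-- First differences of successive predictions decay geometrically, uniformly in the grid. -/
theorem exists_difference_bound {n : ℕ} (hn : n = 1 ∨ n = 3 ∨ n = 5) :
    ∃ K : ℝ, 0 ≤ K ∧ ∀ (J : ℕ → ℕ) (u : ℕ → ℕ → ℝ) (B : ℝ), (∀ k, n ≤ J k) →
      (∀ k, J (k + 1) = 2 * J k) → (∀ k, IsPrediction n (J k) (u k) (u (k + 1))) →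
      (∀ i ≤ J 0, |u 0 i| ≤ B) →
      ∀ k, ∀ j < J k, |u k (j + 1) - u k j| ≤ K * B * (3 / 4) ^ k := by
  obtain ⟨K, hK, hend⟩ := exists_end_difference_bound hn
  -- `K` serves the ends, and the extra `2` covers level `0`, where a difference is at most `2 B`.
  refine ⟨K + 2, by positivity, fun J u B hJn hJ hu hB k => ?_⟩
  have hB0 : 0 ≤ B := (abs_nonneg _).trans (hB 0 (Nat.zero_le _))
  have hleft := hend u B (fun k => (hu k).left hn (hJn k)) fun i hi => hB i (hi.trans (hJn 0))
  have hright := hend (fun k m => u k (J k - m)) B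
    (fun k => by simpa only [hJ] using (hu k).right hn (hJn k)) fun i _ => hB _ (Nat.sub_le _ _)
  have hweak : ∀ k, K * B / 2 ^ k ≤ (K + 2) * B * (3 / 4) ^ k := by
    intro k
    rw [div_eq_mul_inv, ← inv_pow]
    refine mul_le_mul (by nlinarith) (pow_le_pow_left₀ (by norm_num) (by norm_num) k)
      (by positivity) (by positivity)
  induction k with
  | zero =>
    intro j hj
    have a := abs_le.1 (hB j hj.le)
    have b := abs_le.1 (hB (j + 1) hj)
    have := mul_nonneg hK hB0
    rw [pow_zero, mul_one, abs_le]
    constructor <;> linarith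
  | succ k ih =>
    intro j hj
    have hj2 := hj
    rw [hJ] at hj
    have hn' := hJn k
    by_cases hl : j < n
    · exact (hleft _ j hl).trans (hweak _)
    by_cases hr : 2 * J k - (j + 1) < n
    · have := (hright (k + 1) _ hr).trans (hweak _)
      simp only [hJ] at this
      rw [abs_sub_comm] at this
      rwa [show 2 * J k - (2 * J k - (j + 1)) = j + 1 by omega,
        show 2 * J k - (2 * J k - (j + 1) + 1) = j by omega] at this
    have hq : (K + 2) * B * (3 / 4) ^ (k + 1) = 3 / 4 * ((K + 2) * B * (3 / 4) ^ k) := by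
      rw [pow_succ]; ring
    rw [hq]
    obtain ⟨he, ho⟩ := hu k
    -- Away from both ends, the odd one of `j`, `j + 1` carries a centered value, and the even one a
    -- copied value.
    rcases Nat.even_or_odd' j with ⟨i, rfl | rfl⟩
    · have := ho (i + 1) (by omega) (by omega)
      rw [oddRule, if_neg (by omega), if_pos (by omega)] at this
      rw [show 2 * (i + 1) - 1 = 2 * i + 1 by omega] at this
      rw [this, he i (by omega)]
      exact (centeredRule_difference_le hn hn' ih (i := i + 1) (by omega) (by omega)).2
    · have := ho (i + 1) (by omega) (by omega)
      rw [oddRule, if_neg (by omega), if_pos (by omega)] at this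
      rw [show 2 * (i + 1) - 1 = 2 * i + 1 by omega] at this
      rw [this, show 2 * i + 1 + 1 = 2 * (i + 1) by ring, he (i + 1) (by omega)]
      exact (centeredRule_difference_le hn hn' ih (i := i + 1) (by omega) (by omega)).1

/-! ### Uniform bounds and return to the operators. -/

/-- Successive predictions are bounded uniformly in the grid and in the number of steps. -/
theorem exists_prediction_bound {n : ℕ} (hn : n = 1 ∨ n = 3 ∨ n = 5) :
    ∃ C : ℝ, 0 < C ∧ ∀ (J : ℕ → ℕ) (u : ℕ → ℕ → ℝ) (B : ℝ), (∀ k, n ≤ J k) →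
      (∀ k, J (k + 1) = 2 * J k) → (∀ k, IsPrediction n (J k) (u k) (u (k + 1))) →
      (∀ i ≤ J 0, |u 0 i| ≤ B) → ∀ k, ∀ j ≤ J k, |u k j| ≤ C * B := by
  obtain ⟨K, hK, hdiff⟩ := exists_difference_bound hn
  -- `4 = 1 / (1 - 3/4)` is the sum of the geometric series.
  refine ⟨1 + 4 * K, by positivity, fun J u B hJn hJ hu hB => ?_⟩
  have hB0 : 0 ≤ B := (abs_nonneg _).trans (hB 0 (Nat.zero_le _))
  have hd := hdiff J u B hJn hJ hu hB
  have hKB := mul_nonneg hK hB0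
  have key : ∀ k, ∀ j ≤ J k, |u k j| ≤ B + 4 * (K * B) * (1 - (3 / 4) ^ k) := by
    intro k
    induction k with
    | zero => simpa using hB
    | succ k ih =>
      intro j hj
      have hp : (0 : ℝ) < (3 / 4) ^ k := by positivity
      have hmul := mul_nonneg hKB hp.le
      have hj' := hJ k
      rcases Nat.even_or_odd' j with ⟨i, rfl | rfl⟩
      · rw [(hu k).1 i (by omega)]
        refine (ih i (by omega)).trans ?_
        rw [pow_succ]
        nlinarith
      -- The odd value is compared with its left neighbour `2 i`, a copy from level `k`.
      · have a := abs_le.1 (hd (k + 1) (2 * i) (by omega))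
        have b := abs_le.1 (ih i (by omega))
        rw [← (hu k).1 i (by omega)] at b
        rw [pow_succ] at a ⊢
        rw [abs_le]
        constructor <;> nlinarith
  intro k j hj
  refine (key k j hj).trans ?_
  have hp : (0 : ℝ) < (3 / 4) ^ k := by positivity
  nlinarith [mul_nonneg hKB hp.le]

theorem entry_val {J : ℕ} (z : Fin (J + 1) → ℝ) (i : Fin (J + 1)) : entry z i = z i := by
  rw [entry, dif_pos i.2]

theorem abs_entry_le_norm {J : ℕ} (z : Fin (J + 1) → ℝ) (i : ℕ) : |entry z i| ≤ ‖z‖ := by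
  unfold entry
  split
  · exact norm_le_pi_norm z _
  · simp

theorem isPrediction_predictStep (n J : ℕ) (z : Fin (J + 1) → ℝ) :
    IsPrediction n J (entry z) (entry (J := 2 * J) (predictStep n J z)) := by
  refine ⟨fun i hi => ?_, fun i h1 h2 => ?_⟩
  · rw [entry, dif_pos (by omega)]
    simp [predictStep]
  · rw [entry, dif_pos (by omega)]
    simp only [predictStep, LinearMap.coe_mk, AddHom.coe_mk]
    rw [if_neg (by omega), show (2 * i - 1 + 1) / 2 = i by omega]

theorem norm_le_norm_predictStep (n J : ℕ) (z : Fin (J + 1) → ℝ) :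
    ‖z‖ ≤ ‖predictStep n J z‖ := by
  refine (pi_norm_le_iff_of_nonneg (norm_nonneg _)).2 fun i => ?_
  rw [← entry_val z i, ← (isPrediction_predictStep n J z).1 i (Nat.lt_succ_iff.1 i.2)]
  exact abs_entry_le_norm (J := 2 * J) _ _

theorem norm_le_norm_recursivePrediction (n J₀ : ℕ) {ℓ k : ℕ} (h : ℓ ≤ k)
    (z : Fin (gridCells J₀ ℓ + 1) → ℝ) :
    ‖z‖ ≤ ‖recursivePrediction (N := fun k => gridCells J₀ k + 1)
      (interpPrediction n J₀) ℓ k h z‖ := by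
  induction k, h using Nat.le_induction with
  | base => rw [recursivePrediction_self]; rfl
  | succ k h ih =>
    rw [recursivePrediction_succ _ _ _ h]
    exact ih.trans (norm_le_norm_predictStep n _ _)

theorem exists_norm_recursivePrediction_le {n : ℕ} (hn : n = 1 ∨ n = 3 ∨ n = 5) {J₀ : ℕ}
    (hJ₀ : n ≤ J₀) :
    ∃ C : ℝ, 0 < C ∧ ∀ (ℓ k : ℕ) (h : ℓ ≤ k) (z : Fin (gridCells J₀ ℓ + 1) → ℝ),
      ‖recursivePrediction (N := fun k => gridCells J₀ k + 1)
        (interpPrediction n J₀) ℓ k h z‖ ≤ C * ‖z‖ := by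
  obtain ⟨C, hC, hbound⟩ := exists_prediction_bound hn
  refine ⟨C, hC, fun ℓ k h z => ?_⟩
  obtain ⟨k, rfl⟩ := Nat.exists_eq_add_of_le h
  have hgrid : ∀ k, n ≤ gridCells J₀ k := fun k => by
    rw [gridCells_eq]
    exact hJ₀.trans (Nat.le_mul_of_pos_left _ (by positivity))
  -- The sequence is restarted at level `ℓ`; `C` was fixed before the grids, so it does not depend
  -- on `ℓ`.
  have := hbound (fun k => gridCells J₀ (ℓ + k))
    (fun k => entry (recursivePrediction (N := fun k => gridCells J₀ k + 1)
      (interpPrediction n J₀) ℓ (ℓ + k) (Nat.le_add_right ℓ k) z)) ‖z‖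
    (fun k => hgrid _) (fun k => rfl)
    (fun k => by
      have e := recursivePrediction_succ (N := fun k => gridCells J₀ k + 1)
        (interpPrediction n J₀) ℓ (ℓ + k) (Nat.le_add_right ℓ k)
      have e' := congrArg (fun Q => entry (J := gridCells J₀ (ℓ + k + 1)) (Q z)) e
      exact e' ▸ isPrediction_predictStep n _ _)
    (fun i _ => by
      have e := recursivePrediction_self (N := fun k => gridCells J₀ k + 1)
        (interpPrediction n J₀) ℓ
      have e' := congrArg (fun Q => entry (J := gridCells J₀ ℓ) (Q z)) e
      exact (congrArg abs (congrFun e' i)).le.trans (abs_entry_le_norm z i)) k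
  refine (pi_norm_le_iff_of_nonneg (by positivity)).2 fun i => ?_
  have hi := this i (Nat.lt_succ_iff.1 i.2)
  simp only [entry_val] at hi
  exact hi

theorem mainTheorem4 (n : ℕ) (hn : n = 1 ∨ n = 3 ∨ n = 5) (J₀ : ℕ) (hJ₀ : n ≤ J₀) :
    (∃ C : ℝ, 0 < C ∧ ∀ (ℓ k : ℕ) (h : ℓ ≤ k) (ε : Fin (gridCells J₀ ℓ + 1) → ℝ),
      ‖ε‖ ≤ ‖recursivePrediction (N := fun k => gridCells J₀ k + 1)
          (interpPrediction n J₀) ℓ k h ε‖ ∧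
        ‖recursivePrediction (N := fun k => gridCells J₀ k + 1)
          (interpPrediction n J₀) ℓ k h ε‖ ≤ C * ‖ε‖) ∧
    (∃ d₂ : ℝ, PropertySWith (N := fun k => gridCells J₀ k + 1)
      (interpPrediction n J₀) 1 d₂) := by
  obtain ⟨C, hC, hle⟩ := exists_norm_recursivePrediction_le hn hJ₀
  refine ⟨⟨C, hC, fun ℓ k h ε => ⟨norm_le_norm_recursivePrediction n J₀ h ε, hle ℓ k h ε⟩⟩,
    C, one_pos, hC, fun ℓ k h z => ⟨?_, hle ℓ k h.le z⟩⟩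
  rw [one_mul]
  exact norm_le_norm_recursivePrediction n J₀ h.le z
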